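/- Let $F=F^{\otimes\frac12}$ be the Fock space of the neutral fermion over $\mathbb{C}$: the highest weight module, generated by a vacuum vector $|0\rangle$, of the Clifford algebra with generators $\phi_n$, $n\in\mathbb{Z}+\frac12$, and relations $\{\phi_m,\phi_n\}=\delta_{m,-n}$, with $\phi_n|0\rangle=0$ for $n>0$ (equivalently, the exterior algebra on the vectors $\phi_{-m-1/2}|0\rangle$, $m\ge 0$). Let $\phi(z)=\sum_{m\in\mathbb{Z}}\phi_{-m-\frac12}z^{m}$ be the odd neutral fermion field, and write $\partial_{-z}\phi(-z)$ for $(\partial\phi)(-z)$. For fields $a(z)=\sum_k a_{(k)}z^{-k-1}$, $b(z)$ of parities $p(a),p(b)$, put $a(z)_+=\sum_{k<0}a_{(k)}z^{-k-1}$, $a(z)_-=\sum_{k\ge0}a_{(k)}z^{-k-1}$ and $:\!a(z)b(w)\!:\;=a(z)_+b(w)+(-1)^{p(a)p(b)}b(w)a(z)_-$; here $\phi$, its derivative, and their reflections $z\mapsto -z$ are odd. Let $h(z)=\frac12:\!\phi(z)\phi(-z)\!:$, which is even. A field $a(z)$ is (even and) 1-point local if $(z-w)^{n_0}[a(z),a(w)]=0$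 for some $n_0\geq 0$, and 2-point local if $(z-w)^{n_0}(z+w)^{n_1}[a(z),a(w)]=0$ for some $n_0,n_1\geq0$. The Virasoro algebra $Vir$ has generators $L_n$ ($n\in\mathbb{Z}$) and $C$, with $[L_m,L_n]=(m-n)L_{m+n}+\delta_{m,-n}\frac{m^3-m}{12}C$ and $[C,L_m]=0$. A field $L(z)=\sum_n L_nz^{-n-2}$ (respectively a field in $z$ of the form $L(z^2)=\sum_n L_n(z^2)^{-n-2}$, with even powers of $z$ only) is a Virasoro field with central charge $c$ if its modes $L_n$ give a representation of $Vir$ in which $C$ acts as $c\cdot\mathrm{Id}$. Then the following hold on $F$. I. The fields $L^{1/2}(z)=\frac12:\!\partial_z\phi(z)\,\phi(z)\!:$ and $\tilde L^{1/2}(z)=\frac12:\!\partial_{-z}\phi(-z)\,\phi(-z)\!:$ are 1-point local Virasoro fields with central charge $\frac12$, and $\tilde L^{1/2}(z)=L^{1/2}(-z)$. II. The fields $$L^1(z^2)=\frac1{2z^2}:\!h(z)h(z)\!:,\qquad \tilde L^1(z^2)=\frac1{8z^2}\bigl(:\!\partial_z\phi(z)\,\phi(z)\!:+:\!\partial_{-z}\phi(-z)\,\phi(-z)\!:\bigr)+\frac1{32z^4}$$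 are 2-point local Virasoro fields with central charge $1$. III. For all $\lambda,b\in\mathbb{C}$ the field $$L^{\lambda,b}(z^2)=L^1(z^2)+\Bigl(\frac12-\lambda\Bigr)\frac1{2z^2}\partial_zh(z)-\frac b{z^3}h(z)+\frac{16b^2+8b(1-2\lambda)-3(1-2\lambda)^2}{32z^4}$$ is a 2-point local Virasoro field with central charge $-2+12\lambda-12\lambda^2$. Moreover $L^{\frac12,0}(z^2)=L^1(z^2)$ and $L^{\frac12,-\frac14}(z^2)=\tilde L^1(z^2)$. -/

import Mathlib

noncomputable section

namespace NeutralFermion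

open HVertexOperator

attribute [local instance] LieRing.ofAssociativeRing

/-! ### Fields and operations on them

A field `a(z) = ∑ a₍ₙ₎ z^(-n-1)` on `V` is Mathlib's `VertexOperator ℂ V`, and
`HVertexOperator.coeff a k` is its coefficient at `z ^ k` (that is, `a₍₋ₖ₋₁₎`). -/

section Fields

variable {V : Type*} [AddCommGroup V] [Module ℂ V]

theorem exists_coeff_eq_zero (a : VertexOperator ℂ V) (v : V) :
    ∃ B : ℤ, ∀ k < B, coeff a k v = 0 :=
  ⟨_, fun k hk => VertexOperator.coeff_eq_zero_of_lt_order a k v hk⟩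

/-- The field with prescribed coefficients `f k` at `z ^ k`. -/
def mkField (f : ℤ → Module.End ℂ V) (hf : ∀ v, ∃ B : ℤ, ∀ k < B, f k v = 0) :
    VertexOperator ℂ V :=
  VertexOperator.of_coeff f fun v => by
    obtain ⟨B, hB⟩ := hf v
    refine ⟨B, fun k hk => ?_⟩
    by_contra h
    exact hk (hB k (not_le.mp h))

theorem coeff_mkField (f : ℤ → Module.End ℂ V) (hf : ∀ v, ∃ B : ℤ, ∀ k < B, f k v = 0) (k : ℤ) :
    coeff (mkField f hf) k = f k := rfl

/-- The derivative `∂_z a(z)`. -/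
def fieldDeriv (a : VertexOperator ℂ V) : VertexOperator ℂ V :=
  mkField (fun k => ((k : ℂ) + 1) • coeff a (k + 1)) fun v => by
    obtain ⟨B, hB⟩ := exists_coeff_eq_zero a v
    exact ⟨B - 1, fun k hk => by rw [LinearMap.smul_apply, hB _ (by lia), smul_zero]⟩

/-- The field `a(-z)`. -/
def reflect (a : VertexOperator ℂ V) : VertexOperator ℂ V :=
  mkField (fun k => ((-1 : ℂ) ^ k) • coeff a k) fun v => by
    obtain ⟨B, hB⟩ := exists_coeff_eq_zero a v
    exact ⟨B, fun k hk => by rw [LinearMap.smul_apply, hB _ hk, smul_zero]⟩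

/-- The field `z ^ d a(z)`. -/
def zMul (d : ℤ) (a : VertexOperator ℂ V) : VertexOperator ℂ V :=
  mkField (fun k => coeff a (k - d)) fun v => by
    obtain ⟨B, hB⟩ := exists_coeff_eq_zero a v
    exact ⟨B + d, fun k hk => hB _ (by lia)⟩

variable (V) in
/-- The constant field `Id_V`. -/
def idField : VertexOperator ℂ V :=
  mkField (fun k => if k = 0 then 1 else 0) fun v =>
    ⟨0, fun k hk => by rw [if_neg (by lia), LinearMap.zero_apply]⟩

/-- The summand with index `j` in the coefficient at `z ^ n` of
`a(z)₊ b(z) + (-1)^(p q) b(z) a(z)₋`: the part `a(z)₊` consists of the terms of `a(z)` with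
`z ^ j`, `0 ≤ j`, and `a(z)₋` of those with `j < 0`. -/
def normalTerm (p q : ℕ) (a b : VertexOperator ℂ V) (n j : ℤ) : Module.End ℂ V :=
  if 0 ≤ j then coeff a j * coeff b (n - j)
  else ((-1 : ℂ) ^ (p * q)) • (coeff b (n - j) * coeff a j)

theorem normalTerm_support_finite (p q : ℕ) (a b : VertexOperator ℂ V) (n : ℤ) (v : V) :
    (Function.support fun j => normalTerm p q a b n j v).Finite := by
  obtain ⟨A, hA⟩ := exists_coeff_eq_zero a v
  obtain ⟨B, hB⟩ := exists_coeff_eq_zero b v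
  refine (Set.finite_Icc (min A 0) (max (n - B) 0)).subset fun j hj => ?_
  by_contra hmem
  apply hj
  simp only [Set.mem_Icc, not_and_or, not_le] at hmem
  show normalTerm p q a b n j v = 0
  unfold normalTerm
  split_ifs with h
  · rw [Module.End.mul_apply, hB _ (by lia), map_zero]
  · rw [LinearMap.smul_apply, Module.End.mul_apply, hA _ (by lia), map_zero, smul_zero]

/-- The normal ordered product `:a(z)b(z):` of a field `a` of parity `p` and a field `b` of
parity `q` (`0` even, `1` odd). -/
def normalOrder (p q : ℕ) (a b : VertexOperator ℂ V) : VertexOperator ℂ V :=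
  mkField
    (fun n =>
      { toFun := fun v => ∑ᶠ j : ℤ, normalTerm p q a b n j v
        map_add' := fun v w => by
          simp only [map_add]
          exact finsum_add_distrib (normalTerm_support_finite p q a b n v)
            (normalTerm_support_finite p q a b n w)
        map_smul' := fun c v => by
          simp only [map_smul, RingHom.id_apply]
          exact (smul_finsum c _).symm })
    fun v => by
      obtain ⟨A, hA⟩ := exists_coeff_eq_zero a v
      obtain ⟨B, hB⟩ := exists_coeff_eq_zero b v
      choose C hC using fun j : ℤ => exists_coeff_eq_zero b (coeff a j v)
      obtain ⟨D, hD⟩ := ((Set.finite_Ico A 0).image fun j => C j + j).bddBelow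
      refine ⟨min B D, fun n hn => ?_⟩
      show ∑ᶠ j : ℤ, normalTerm p q a b n j v = 0
      rw [← finsum_zero (α := ℤ)]
      congr 1
      funext j
      unfold normalTerm
      split_ifs with h
      · rw [Module.End.mul_apply, hB _ (by lia), map_zero]
      · rw [LinearMap.smul_apply, Module.End.mul_apply]
        by_cases hj : j < A
        · rw [hA _ hj, map_zero, smul_zero]
        · have := hD (Set.mem_image_of_mem (fun j => C j + j)
            (show j ∈ Set.Ico A 0 from ⟨by lia, by lia⟩))
          rw [hC j _ (by lia), smul_zero]

/-! ### Locality -/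

/-- Multiplication of a formal distribution `∑ c i j z^i w^j` by `z - μ w`. -/
def mulSub {E : Type*} [AddCommGroup E] [Module ℂ E] (μ : ℂ) : Module.End ℂ (ℤ → ℤ → E) where
  toFun c i j := c (i - 1) j - μ • c i (j - 1)
  map_add' c d := by
    funext i j
    simp only [Pi.add_apply, smul_add]
    abel
  map_smul' r c := by
    funext i j
    simp only [Pi.smul_apply, RingHom.id_apply, smul_sub, smul_comm r μ]

/-- `a(z)` is `N`-point self-local at `1, ε, …, ε^(N-1)` of parity `p` (`0` even, `1` odd):
for some exponents,
`∏ (z - ε^k w)^(n k) (a(z)a(w) - (-1)^p a(w)a(z)) = 0`. -/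
def IsSelfLocal (N : ℕ) (ε : ℂ) (p : ℕ) (a : VertexOperator ℂ V) : Prop :=
  ∃ n : Fin N → ℕ,
    (List.ofFn fun k : Fin N => mulSub (E := Module.End ℂ V) (ε ^ (k : ℕ)) ^ n k).prod
      (fun i j => coeff a i * coeff a j - ((-1 : ℂ) ^ p) • (coeff a j * coeff a i)) = 0

end Fields

/-! ### The Virasoro algebra -/

/-- Generators of the Virasoro algebra. -/
inductive VirGen
  | L : ℤ → VirGen
  | C : VirGen

/-- The relations `[L_m, L_n] = (m - n) L_{m+n} + δ_{m,-n} (m³ - m)/12 C` and `[C, L_m] = 0`. -/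
def virRelations : Set (FreeLieAlgebra ℂ VirGen) :=
  (Set.range fun mn : ℤ × ℤ =>
    ⁅FreeLieAlgebra.of ℂ (VirGen.L mn.1), FreeLieAlgebra.of ℂ (VirGen.L mn.2)⁆
      - (((mn.1 : ℂ) - mn.2) • FreeLieAlgebra.of ℂ (VirGen.L (mn.1 + mn.2))
        + (if mn.1 = -mn.2 then ((mn.1 : ℂ) ^ 3 - mn.1) / 12 else 0) •
            FreeLieAlgebra.of ℂ VirGen.C)) ∪
  (Set.range fun m : ℤ => ⁅FreeLieAlgebra.of ℂ VirGen.C, FreeLieAlgebra.of ℂ (VirGen.L m)⁆)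

/-- The ideal generated by the Virasoro relations. -/
def virIdeal : LieIdeal ℂ (FreeLieAlgebra ℂ VirGen) :=
  LieSubmodule.lieSpan ℂ (FreeLieAlgebra ℂ VirGen) virRelations

/-- The Virasoro algebra. -/
abbrev Vir : Type := FreeLieAlgebra ℂ VirGen ⧸ virIdeal

/-- The class of a generator in the Virasoro algebra. -/
def virOf (x : VirGen) : Vir := LieSubmodule.Quotient.mk (N := virIdeal) (FreeLieAlgebra.of ℂ x)

/-- The field `a(z) = L(z^N)` is a Virasoro field in the variable `z^N` with central charge `c`:
only powers of `z^N` occur, `a(z) = ∑ L_n (z^N)^(-n-2)`, and the modes `L_n` define a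
representation of the Virasoro algebra in which `C` acts as the scalar `c`. -/
def IsVirasoroField {V : Type*} [AddCommGroup V] [Module ℂ V] (N : ℕ) (c : ℂ)
    (a : VertexOperator ℂ V) : Prop :=
  (∀ k : ℤ, ¬ (N : ℤ) ∣ k → coeff a k = 0) ∧
  ∃ ρ : Vir →ₗ⁅ℂ⁆ Module.End ℂ V,
    ρ (virOf VirGen.C) = c • (1 : Module.End ℂ V) ∧
    ∀ n : ℤ, ρ (virOf (VirGen.L n)) = coeff a ((N : ℤ) * (-n - 2))

/-! ### The Fock space of the neutral fermion -/

/-- The Fock space `F^{⊗1/2}`: the exterior algebra on `e₀, e₁, …`, where `e_m` stands for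
`φ_{-m-1/2}|0⟩`. -/
abbrev Fock : Type := ExteriorAlgebra ℂ (ℕ →₀ ℂ)

/-- The vacuum vector `|0⟩`. -/
def vacuum : Fock := 1

/-- The operator `φ_{-k-1/2}`, the coefficient of `φ(z)` at `z ^ k`: exterior multiplication by
`e_k` for `0 ≤ k`, contraction with the dual vector of `e_{-k-1}` for `k < 0`. -/
def phiMode (k : ℤ) : Module.End ℂ Fock :=
  if 0 ≤ k then LinearMap.mulLeft ℂ (ExteriorAlgebra.ι ℂ (Finsupp.single k.toNat (1 : ℂ)))
  else CliffordAlgebra.contractLeft (Q := (0 : QuadraticForm ℂ (ℕ →₀ ℂ)))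
    (Finsupp.lapply (-k - 1).toNat)

/-- The Clifford relations `{φ_{-m-1/2}, φ_{-n-1/2}} = δ_{m+n,-1}`. -/
theorem phiMode_anticomm (m n : ℤ) :
    phiMode m * phiMode n + phiMode n * phiMode m = if m + n = -1 then 1 else 0 := by
  wlog hmn : n ≤ m generalizing m n with H
  · rw [add_comm, H n m (by lia), add_comm n m]
  refine LinearMap.ext fun x => ?_
  by_cases hm : 0 ≤ m <;> by_cases hn : 0 ≤ n
  · simp only [phiMode, hm, hn, if_true, LinearMap.add_apply, Module.End.mul_apply,
      LinearMap.mulLeft_apply, ← mul_assoc, ← add_mul]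
    rw [if_neg (by lia), ExteriorAlgebra.ι_add_mul_swap, zero_mul, LinearMap.zero_apply]
  · simp only [phiMode, hm, hn, if_true, if_false, LinearMap.add_apply, Module.End.mul_apply,
      LinearMap.mulLeft_apply]
    rw [ExteriorAlgebra.ι, CliffordAlgebra.contractLeft_ι_mul, add_sub_cancel,
      Finsupp.lapply_apply, Finsupp.single_apply]
    by_cases h : m + n = -1
    · rw [if_pos (by lia), if_pos h, one_smul, Module.End.one_apply]
    · rw [if_neg (by lia), if_neg h, zero_smul, LinearMap.zero_apply]
  · lia
  · simp only [phiMode, hm, hn, if_false, LinearMap.add_apply, Module.End.mul_apply]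
    rw [CliffordAlgebra.contractLeft_comm, neg_add_cancel, if_neg (by lia), LinearMap.zero_apply]

/-- `φ_n |0⟩ = 0` for `n > 0`. -/
theorem phiMode_vacuum (k : ℤ) (hk : k < 0) : phiMode k vacuum = 0 := by
  rw [phiMode, if_neg (by lia), vacuum, CliffordAlgebra.contractLeft_one]

/-- The vacuum generates the Fock space under the operators `φ_n`. -/
theorem fock_cyclic (W : Submodule ℂ Fock) (hvac : vacuum ∈ W)
    (hW : ∀ k, ∀ x ∈ W, phiMode k x ∈ W) : W = ⊤ := by
  refine eq_top_iff.mpr fun x _ => ?_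
  induction x using CliffordAlgebra.left_induction with
  | algebraMap r =>
    rw [Algebra.algebraMap_eq_smul_one]
    exact W.smul_mem r hvac
  | add x y hx hy => exact W.add_mem (hx trivial) (hy trivial)
  | ι_mul x m hx =>
    replace hx := hx trivial
    clear * - hW hx
    induction m using Finsupp.induction_linear with
    | zero => rw [map_zero, zero_mul]; exact W.zero_mem
    | add f g hf hg => rw [map_add, add_mul]; exact W.add_mem hf hg
    | single i c =>
      have h := W.smul_mem c (hW i x hx)
      rw [phiMode, if_pos (by lia), LinearMap.mulLeft_apply, ← smul_mul_assoc, ← map_smul,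
        Finsupp.smul_single, smul_eq_mul, mul_one, Int.toNat_natCast] at h
      exact h

theorem phiMode_field (x : Fock) : ∃ B : ℤ, ∀ k < B, phiMode k x = 0 := by
  let W : Submodule ℂ Fock :=
    { carrier := {x | ∃ B : ℤ, ∀ k < B, phiMode k x = 0}
      zero_mem' := ⟨0, fun k _ => map_zero _⟩
      add_mem' := by
        rintro x y ⟨B, hB⟩ ⟨D, hD⟩
        exact ⟨min B D, fun k hk => by rw [map_add, hB _ (by lia), hD _ (by lia), add_zero]⟩
      smul_mem' := by
        rintro c x ⟨B, hB⟩
        exact ⟨B, fun k hk => by rw [map_smul, hB _ hk, smul_zero]⟩ }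
  have hW : W = ⊤ := fock_cyclic W ⟨0, fun k hk => phiMode_vacuum k hk⟩ fun m x hx => by
    obtain ⟨B, hB⟩ := hx
    refine ⟨min B (-1 - m), fun k hk => ?_⟩
    have h := LinearMap.congr_fun (phiMode_anticomm k m) x
    rw [if_neg (by lia), LinearMap.add_apply, Module.End.mul_apply, Module.End.mul_apply,
      hB k (by lia), map_zero, add_zero] at h
    exact h
  have hx : x ∈ W := hW ▸ Submodule.mem_top
  exact hx

/-- The neutral fermion field `φ(z) = ∑ φ_{-m-1/2} z^m`; it is odd. -/
def phi : VertexOperator ℂ Fock := mkField phiMode phiMode_field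

/-- `h(z) = ½ :φ(z)φ(-z):`; this field is even. -/
def heis : VertexOperator ℂ Fock := (1 / 2 : ℂ) • normalOrder 1 1 phi (reflect phi)

/-! ### The Virasoro fields -/

/-- `L^{1/2}(z) = ½ :∂φ(z) φ(z):`. -/
def LHalf : VertexOperator ℂ Fock := (1 / 2 : ℂ) • normalOrder 1 1 (fieldDeriv phi) phi

/-- `L̃^{1/2}(z) = ½ :∂_{-z}φ(-z) φ(-z):`, where `∂_{-z}φ(-z) = (∂φ)(-z)`. -/
def LHalfTilde : VertexOperator ℂ Fock :=
  (1 / 2 : ℂ) • normalOrder 1 1 (reflect (fieldDeriv phi)) (reflect phi)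

/-- `L¹(z²) = 1/(2z²) :h(z)h(z):`, as a series in `z`. -/
def LOne : VertexOperator ℂ Fock := (1 / 2 : ℂ) • zMul (-2) (normalOrder 0 0 heis heis)

/-- `L̃¹(z²) = 1/(8z²) (:∂φ(z) φ(z): + :∂_{-z}φ(-z) φ(-z):) + 1/(32z⁴)`. -/
def LOneTilde : VertexOperator ℂ Fock :=
  (1 / 8 : ℂ) • zMul (-2)
      (normalOrder 1 1 (fieldDeriv phi) phi + normalOrder 1 1 (reflect (fieldDeriv phi)) (reflect phi))
    + (1 / 32 : ℂ) • zMul (-4) (idField Fock)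

/-- `L^{l,b}(z²) = L¹(z²) + (½ - l)/(2z²) ∂h(z) - b/z³ h(z)
+ (16b² + 8b(1-2l) - 3(1-2l)²)/(32z⁴)`. -/
def LFamily (l b : ℂ) : VertexOperator ℂ Fock :=
  LOne + ((1 / 2 - l) / 2) • zMul (-2) (fieldDeriv heis) - b • zMul (-3) heis
    + ((16 * b ^ 2 + 8 * b * (1 - 2 * l) - 3 * (1 - 2 * l) ^ 2) / 32) • zMul (-4) (idField Fock)

end NeutralFermion

end

/-! Every field here has modes that are normal ordered quadratic expressions `quad n f` = ∑ f(i)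
:φ₍ᵢ₎φ₍ₙ₋ᵢ₎: in the fermion modes, up to scalars. The commutator of such an expression with φ₍ₖ₎ is
a multiple of one shifted mode (`quad_mul_phiMode`), so the commutator of two of them is again
quadratic plus a scalar (`quad_commutator`). The scalar arises because shifting the summation index
moves the cut of the normal ordering; moving it back adds a telescoping sum, computed from a
discrete antiderivative `G` of the weights. All central terms come from this mechanism.

With T the quadratic modes of ¼z⁻²:∂φ(z)φ(z): (`quarterMode`) and h the Heisenberg modes, three
commutators [T,T], [T,h], [h,h] give the relations for the whole two-parameter family
(`modes_commutator`). They say that h₀ + ¼ and T₀ + 1/32 are the natural zero modes: with these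
shifts h is primary of weight 1 and T is Virasoro with c = 1, and adding (μ - an)hₙ and a constant
is the usual deformation with c = 1 - 12a².

The substantial point is that :h(z)h(z): is quadratic, not quartic, in the fermions
(`coeff_normalOrder_heis_heis`). An operator that commutes or anticommutes with all φ₍ₖ₎ and has
zero vacuum expectation vanishes (`eq_zero_of_semicommute`), so it suffices to compare brackets with
φ₍ₖ₎. Those of :hh: reduce to :hφ:, which by the same principle is linear in the φ₍ₖ₎
(`coeff_normalOrder_heis_phi`).

Locality follows from the Virasoro relations alone: at fixed i + j the commutator is polynomial of
degree at most 3 in i, so a fourth difference kills it. -/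

noncomputable section

namespace NeutralFermion

open HVertexOperator

attribute [local instance] LieRing.ofAssociativeRing

/-! ### Virasoro fields from relations between their modes -/

section Modes

variable {V : Type*} [AddCommGroup V] [Module ℂ V]

/-- The field `a(z) = L(z^N)` has only powers of `z^N`, and its modes satisfy the Virasoro
relations with central charge `c`. -/
def HasVirasoroModes (N : ℕ) (c : ℂ) (a : VertexOperator ℂ V) : Prop :=
  (∀ k : ℤ, ¬ (N : ℤ) ∣ k → coeff a k = 0) ∧
  ∀ m n : ℤ, coeff a ((N : ℤ) * (-m - 2)) * coeff a ((N : ℤ) * (-n - 2))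
      - coeff a ((N : ℤ) * (-n - 2)) * coeff a ((N : ℤ) * (-m - 2))
    = ((m : ℂ) - n) • coeff a ((N : ℤ) * (-(m + n) - 2))
      + (if m = -n then ((m : ℂ) ^ 3 - m) / 12 * c else 0) • (1 : Module.End ℂ V)

/-- A Lie algebra morphism on the free Lie algebra that kills the Virasoro relations descends to
the Virasoro algebra. -/
theorem exists_vir_lift {L : Type*} [LieRing L] [LieAlgebra ℂ L]
    (F : FreeLieAlgebra ℂ VirGen →ₗ⁅ℂ⁆ L) (hF : ∀ x ∈ virRelations, F x = 0) :
    ∃ ρ : Vir →ₗ⁅ℂ⁆ L, ∀ x, ρ (virOf x) = F (FreeLieAlgebra.of ℂ x) := by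
  have hle : virIdeal ≤ F.ker :=
    LieSubmodule.lieSpan_le.mpr fun x hx => (LieHom.mem_ker).mpr (hF x hx)
  refine ⟨{ virIdeal.toSubmodule.liftQ (F : FreeLieAlgebra ℂ VirGen →ₗ[ℂ] L)
      (fun x hx => (LieHom.mem_ker).mp (hle hx)) with
    map_lie' := ?_ }, fun x => rfl⟩
  intro x y
  induction x using Submodule.Quotient.induction_on
  induction y using Submodule.Quotient.induction_on
  exact F.map_lie _ _

theorem HasVirasoroModes.isVirasoroField {N : ℕ} {c : ℂ} {a : VertexOperator ℂ V}
    (h : HasVirasoroModes N c a) : IsVirasoroField N c a := by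
  refine ⟨h.1, ?_⟩
  let g : VirGen → Module.End ℂ V := fun x =>
    match x with
    | VirGen.L n => coeff a ((N : ℤ) * (-n - 2))
    | VirGen.C => c • 1
  obtain ⟨ρ, hρ⟩ := exists_vir_lift (FreeLieAlgebra.lift ℂ g) (by
    rintro x (⟨⟨m, n⟩, rfl⟩ | ⟨m, rfl⟩)
    · simp only [map_sub, map_add, map_smul, LieHom.map_lie, FreeLieAlgebra.lift_of_apply, g]
      rw [LieRing.of_associative_ring_bracket, h.2 m n, smul_smul]
      simp only [ite_mul, zero_mul, sub_self]
    · simp only [LieHom.map_lie, FreeLieAlgebra.lift_of_apply, g]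
      rw [LieRing.of_associative_ring_bracket]
      simp)
  exact ⟨ρ, by rw [hρ, FreeLieAlgebra.lift_of_apply], fun n => by
    rw [hρ, FreeLieAlgebra.lift_of_apply]⟩

/-- Reflection replaces Lₙ by (-1)ⁿLₙ. Since n ↦ (-1)ⁿ is a character, both sides of a relation
scale alike, and the central term occurs only where the sign is 1. -/
theorem HasVirasoroModes.reflect {c : ℂ} {a : VertexOperator ℂ V}
    (h : HasVirasoroModes 1 c a) : HasVirasoroModes 1 c (reflect a) := by
  refine ⟨fun k hk => (hk (by simp)).elim, fun m n => ?_⟩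
  have h2 := h.2 m n
  simp only [NeutralFermion.reflect, coeff_mkField]
  generalize coeff a (((1 : ℕ) : ℤ) * (-m - 2)) = A at *
  generalize coeff a (((1 : ℕ) : ℤ) * (-n - 2)) = B at *
  generalize hC : coeff a (((1 : ℕ) : ℤ) * (-(m + n) - 2)) = C at *
  have hs : ∀ k : ℤ, (-1 : ℂ) ^ (((1 : ℕ) : ℤ) * (-k - 2)) = (-1) ^ k := fun k => by
    rcases Int.even_or_odd k with hk | hk
    · rw [hk.neg_one_zpow, Even.neg_one_zpow]; grind
    · rw [hk.neg_one_zpow, Odd.neg_one_zpow]; grind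
  rw [hs, hs, hs, zpow_add₀ (by norm_num)]
  have := congrArg (fun X => (((-1 : ℂ) ^ m) * (-1) ^ n) • X) h2
  simp only [smul_sub, smul_add, smul_smul] at this
  simp only [smul_mul_smul_comm]
  rw [mul_comm ((-1 : ℂ) ^ n) ((-1) ^ m), this, mul_comm _ ((m : ℂ) - n), mul_smul]
  congr 2
  split_ifs with hmn
  · subst hmn
    rw [← zpow_add₀ (by norm_num)]
    simp
  · simp

/-- Multiplication by z - w is a difference operator along the lines i + j = const, where the
commutator is a polynomial in i of degree at most 3; hence the exponent 4. -/
theorem HasVirasoroModes.isSelfLocal_one {c : ℂ} {a : VertexOperator ℂ V}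
    (h : HasVirasoroModes 1 c a) : IsSelfLocal 1 1 0 a := by
  have key : ∀ i j : ℤ, coeff a i * coeff a j - ((-1 : ℂ) ^ 0) • (coeff a j * coeff a i)
      = ((j : ℂ) - i) • coeff a (i + j + 2)
        + (if i + j = -4 then ((-i - 2 : ℂ) ^ 3 - (-i - 2)) / 12 * c else 0) • 1 := by
    intro i j
    have := h.2 (-i - 2) (-j - 2)
    rw [show ((1 : ℕ) : ℤ) * (-(-i - 2) - 2) = i by push_cast; ring,
      show ((1 : ℕ) : ℤ) * (-(-j - 2) - 2) = j by push_cast; ring,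
      show ((1 : ℕ) : ℤ) * (-(-i - 2 + (-j - 2)) - 2) = i + j + 2 by push_cast; ring] at this
    rw [pow_zero, one_smul, this]
    push_cast
    refine congrArg₂ (· + ·) (congrArg (· • _) (by ring)) ?_
    exact congrArg (· • _) (if_congr (by lia) rfl rfl)
  refine ⟨fun _ => 4, ?_⟩
  simp only [key, List.ofFn_succ, List.ofFn_zero, List.prod_cons, List.prod_nil, mul_one]
  funext i j
  simp only [Fin.coe_ofNat_eq_mod, Nat.zero_mod, pow_zero, pow_succ, one_mul, Module.End.mul_apply,
    mulSub, LinearMap.coe_mk, AddHom.coe_mk, one_smul, Pi.zero_apply]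
  have e1 : ∀ p q : ℤ, p + q = i + j - 4 → coeff a (p + q + 2) = coeff a (i + j - 2) :=
    fun p q hpq => by rw [hpq, show i + j - 4 + 2 = i + j - 2 by ring]
  have e2 : ∀ p q : ℤ, p + q = i + j - 4 → ∀ x : ℂ, (if p + q = -4 then x else 0)
    = (if i + j = 0 then x else 0) := fun p q hpq x => if_congr (by lia) rfl rfl
  simp only [e1 (i - 1 - 1 - 1 - 1) j (by ring), e1 (i - 1 - 1 - 1) (j - 1) (by ring),
    e1 (i - 1 - 1) (j - 1 - 1) (by ring), e1 (i - 1) (j - 1 - 1 - 1) (by ring),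
    e1 i (j - 1 - 1 - 1 - 1) (by ring), e2 (i - 1 - 1 - 1 - 1) j (by ring),
    e2 (i - 1 - 1 - 1) (j - 1) (by ring), e2 (i - 1 - 1) (j - 1 - 1) (by ring),
    e2 (i - 1) (j - 1 - 1 - 1) (by ring), e2 i (j - 1 - 1 - 1 - 1) (by ring)]
  push_cast
  split_ifs
  · module
  · module

/-- Here (z - w)(z + w) = z² - w² is a difference operator of step 2. It preserves the parities of
both indices, so the one-point argument applies on even indices, the only ones where the commutator
can be nonzero. -/
theorem HasVirasoroModes.isSelfLocal_two {c : ℂ} {a : VertexOperator ℂ V}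
    (h : HasVirasoroModes 2 c a) : IsSelfLocal 2 (-1) 0 a := by
  have key : ∀ i j : ℤ, coeff a i * coeff a j - ((-1 : ℂ) ^ 0) • (coeff a j * coeff a i)
      = if 2 ∣ i ∧ 2 ∣ j then (((j : ℂ) - i) / 2) • coeff a (i + j + 4)
        + (if i + j = -8 then ((-i / 2 - 2 : ℂ) ^ 3 - (-i / 2 - 2)) / 12 * c else 0) • 1
        else 0 := by
    intro i j
    by_cases hij : 2 ∣ i ∧ 2 ∣ j
    · rw [if_pos hij]
      obtain ⟨⟨i, rfl⟩, ⟨j, rfl⟩⟩ := hij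
      have := h.2 (-i - 2) (-j - 2)
      rw [show ((2 : ℕ) : ℤ) * (-(-i - 2) - 2) = 2 * i by push_cast; ring,
        show ((2 : ℕ) : ℤ) * (-(-j - 2) - 2) = 2 * j by push_cast; ring,
        show ((2 : ℕ) : ℤ) * (-(-i - 2 + (-j - 2)) - 2) = 2 * i + 2 * j + 4 by
          push_cast; ring] at this
      rw [pow_zero, one_smul, this]
      push_cast
      refine congrArg₂ (· + ·) (congrArg (· • _) (by ring)) ?_
      exact congrArg (· • _) (if_congr (by lia) (by ring) rfl)
    · rw [if_neg hij]
      rw [not_and_or] at hij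
      rcases hij with hi | hi <;> simp [h.1 _ hi]
  refine ⟨fun _ => 4, ?_⟩
  have hcomm : Commute (mulSub (E := Module.End ℂ V) 1) (mulSub (-1)) := by
    refine LinearMap.ext fun x => ?_
    funext i j
    simp only [Module.End.mul_apply, mulSub, LinearMap.coe_mk, AddHom.coe_mk]
    module
  have hprod : ∀ (x : ℤ → ℤ → Module.End ℂ V) i j,
      (mulSub 1 * mulSub (-1) : Module.End ℂ (ℤ → ℤ → Module.End ℂ V)) x i j = x (i - 2) j - x i (j - 2) := by
    intro x i j
    simp only [Module.End.mul_apply, mulSub, LinearMap.coe_mk, AddHom.coe_mk]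
    rw [show i - 1 - 1 = i - 2 by ring, show j - 1 - 1 = j - 2 by ring]
    module
  simp only [key, List.ofFn_succ, List.ofFn_zero, List.prod_cons, List.prod_nil, mul_one]
  simp only [Fin.coe_ofNat_eq_mod, Nat.zero_mod, pow_zero, Fin.val_succ, zero_add, pow_one]
  rw [← hcomm.mul_pow]
  funext i j
  simp only [pow_succ _ 3, pow_succ _ 2, pow_succ _ 1, pow_one]
  rw [Module.End.mul_apply, Module.End.mul_apply, Module.End.mul_apply]
  simp only [hprod, Pi.zero_apply]
  have e0 : ∀ k : ℤ, (2 ∣ k - 2) = (2 ∣ k) := fun k => propext (by lia)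
  simp only [e0]
  have e1 : ∀ p q : ℤ, p + q = i + j - 8 → coeff a (p + q + 4) = coeff a (i + j - 4) :=
    fun p q hpq => by rw [hpq, show i + j - 8 + 4 = i + j - 4 by ring]
  have e2 : ∀ p q : ℤ, p + q = i + j - 8 → ∀ x : ℂ, (if p + q = -8 then x else 0)
    = (if i + j = 0 then x else 0) := fun p q hpq x => if_congr (by lia) rfl rfl
  simp only [e1 (i - 2 - 2 - 2 - 2) j (by ring), e1 (i - 2 - 2 - 2) (j - 2) (by ring),
    e1 (i - 2 - 2) (j - 2 - 2) (by ring), e1 (i - 2) (j - 2 - 2 - 2) (by ring),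
    e1 i (j - 2 - 2 - 2 - 2) (by ring), e2 (i - 2 - 2 - 2 - 2) j (by ring),
    e2 (i - 2 - 2 - 2) (j - 2) (by ring), e2 (i - 2 - 2) (j - 2 - 2) (by ring),
    e2 (i - 2) (j - 2 - 2 - 2) (by ring), e2 i (j - 2 - 2 - 2 - 2) (by ring)]
  push_cast
  split_ifs
  · module
  · module
  · module

end Modes

/-! ### Pointwise finite sums of operators -/

section LocSum

variable {ι V : Type*} [AddCommGroup V] [Module ℂ V]

/-- On every vector only finitely many of the operators `X j` are nonzero, and they sum up
to `T`. -/
def LocSum (X : ι → Module.End ℂ V) (T : Module.End ℂ V) : Prop :=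
  ∀ v, (Function.support fun j => X j v).Finite ∧ ∑ᶠ j, X j v = T v

namespace LocSum

variable {X Y : ι → Module.End ℂ V} {S T : Module.End ℂ V}

/-- This turns an identity of operators into a termwise identity of summands; nearly all operator
identities below are proved this way. -/
theorem unique (h : LocSum X S) (h' : LocSum X T) : S = T :=
  LinearMap.ext fun v => (h v).2.symm.trans (h' v).2

theorem exists_of_finite (h : ∀ v, (Function.support fun j => X j v).Finite) :
    ∃ T, LocSum X T :=
  ⟨{ toFun := fun v => ∑ᶠ j, X j v
     map_add' := fun v w => by
       simp only [map_add]
       exact finsum_add_distrib (h v) (h w)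
     map_smul' := fun c v => by
       simp only [map_smul, RingHom.id_apply]
       exact (smul_finsum c _).symm }, fun v => ⟨h v, rfl⟩⟩

theorem congr (h : LocSum X T) (hXY : ∀ j, X j = Y j) (hT : T = S) : LocSum Y S := by
  obtain rfl : X = Y := funext hXY
  exact hT ▸ h

theorem add (hX : LocSum X S) (hY : LocSum Y T) : LocSum (fun j => X j + Y j) (S + T) := fun v =>
  ⟨((hX v).1.union (hY v).1).subset (Function.support_add _ _), by
    rw [LinearMap.add_apply, ← (hX v).2, ← (hY v).2, ← finsum_add_distrib (hX v).1 (hY v).1]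
    rfl⟩

theorem mul_left (A : Module.End ℂ V) (h : LocSum X T) : LocSum (fun j => A * X j) (A * T) :=
  fun v => ⟨(h v).1.subset fun _ hj hz => hj (by
      exact (congrArg A hz).trans (map_zero A)), by
    rw [Module.End.mul_apply, ← (h v).2]
    exact (A.toAddMonoidHom.map_finsum (h v).1).symm⟩

theorem mul_right (A : Module.End ℂ V) (h : LocSum X T) : LocSum (fun j => X j * A) (T * A) :=
  fun v => h (A v)

theorem smul (c : ℂ) (h : LocSum X T) : LocSum (fun j => c • X j) (c • T) :=
  (h.mul_left (c • 1)).congr (fun j => by rw [smul_mul_assoc, one_mul])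
    (by rw [smul_mul_assoc, one_mul])

theorem neg (h : LocSum X T) : LocSum (fun j => -X j) (-T) :=
  (h.smul (-1)).congr (fun j => by rw [neg_one_smul]) (by rw [neg_one_smul])

theorem sub (hX : LocSum X S) (hY : LocSum Y T) : LocSum (fun j => X j - Y j) (S - T) :=
  (hX.add hY.neg).congr (fun _ => (sub_eq_add_neg _ _).symm) (sub_eq_add_neg _ _).symm

theorem single [DecidableEq ι] (a : ι) (Y : ι → Module.End ℂ V) :
    LocSum (fun j => if j = a then Y j else 0) (Y a) := fun v => by
  constructor
  · refine (Set.finite_singleton a).subset fun j hj => ?_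
    by_contra hja
    exact hj (by simp only [if_neg (show j ≠ a from hja), LinearMap.zero_apply])
  · rw [finsum_eq_single _ a fun j hj => by simp [hj]]
    simp

theorem comp_equiv {κ : Type*} (e : κ ≃ ι) (h : LocSum X T) : LocSum (fun j => X (e j)) T :=
  fun v => ⟨((h v).1.preimage e.injective.injOn), by
    rw [← (h v).2]
    exact finsum_comp_equiv e (f := fun j => X j v)⟩

/-- Changing the cut of a normal ordering from `0` to `K`, when the two orderings differ by
multiples of one operator with telescoping coefficients. -/
theorem cutoff {A B : ℤ → Module.End ℂ V} {C T : Module.End ℂ V} {G : ℤ → ℂ}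
    (hG : ∀ i, A i - B i = (G (i + 1) - G i) • C)
    (h : LocSum (fun i => if 0 ≤ i then A i else B i) T) (K : ℤ) :
    LocSum (fun i => if K ≤ i then A i else B i) (T - (G K - G 0) • C) := by
  induction K with
  | zero => exact h.congr (fun _ => rfl) (by simp)
  | succ k ih =>
    refine (ih.sub (single (k : ℤ) fun i => A i - B i)).congr (fun j => ?_) ?_
    · rcases lt_trichotomy j k with hj | rfl | hj
      · rw [if_neg (by lia), if_neg (by lia), if_neg (by lia), sub_zero]
      · rw [if_pos le_rfl, if_pos rfl, if_neg (by lia), sub_sub_cancel]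
      · rw [if_pos (by lia), if_neg (by lia), if_pos (by lia), sub_zero]
    · rw [hG]
      module
  | pred k ih =>
    refine (ih.add (single (-(k : ℤ) - 1) fun i => A i - B i)).congr (fun j => ?_) ?_
    · rcases lt_trichotomy j (-(k : ℤ) - 1) with hj | rfl | hj
      · rw [if_neg (by lia), if_neg (by lia), if_neg (by lia), add_zero]
      · rw [if_neg (by lia), if_pos rfl, if_pos le_rfl, add_sub_cancel]
      · rw [if_pos (by lia), if_neg (by lia), if_pos (by lia), add_zero]
    · rw [hG, sub_add_cancel]
      module

end LocSum

theorem locSum_normalOrder (p q : ℕ) (a b : VertexOperator ℂ V) (n : ℤ) :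
    LocSum (normalTerm p q a b n) (coeff (normalOrder p q a b) n) := fun v =>
  ⟨normalTerm_support_finite p q a b n v, rfl⟩

theorem mul_neg_sub_neg_mul (A X : Module.End ℂ V) : A * -X - -X * A = X * A - A * X := by
  rw [mul_neg, neg_mul]
  abel

end LocSum

/-! ### Operators that (anti)commute with the fermion modes -/

/-- The linear functional dual to the vacuum vector. -/
def vacuumFunctional : Fock →ₗ[ℂ] ℂ := (ExteriorAlgebra.algebraMapInv (R := ℂ)).toLinearMap

theorem vacuumFunctional_vacuum : vacuumFunctional vacuum = 1 :=
  map_one (ExteriorAlgebra.algebraMapInv (R := ℂ) (M := ℕ →₀ ℂ))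

theorem vacuumFunctional_phiMode (k : ℤ) (hk : 0 ≤ k) (x : Fock) :
    vacuumFunctional (phiMode k x) = 0 := by
  simp [phiMode, hk, vacuumFunctional, ExteriorAlgebra.algebraMapInv]

theorem phiMode_mul_comm (m n : ℤ) :
    phiMode m * phiMode n = (if m + n = -1 then 1 else 0) - phiMode n * phiMode m :=
  eq_sub_of_add_eq (phiMode_anticomm m n)

/-- The projection to the vectors annihilated by `φ_{1/2}, …, φ_{M-1/2}`. -/
def annihilatedProj : ℕ → Module.End ℂ Fock
  | 0 => 1
  | M + 1 => annihilatedProj M * (phiMode (-1 - M) * phiMode M)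

theorem annihilatedProj_apply_of_annihilated {y : Fock} (hy : ∀ k < 0, phiMode k y = 0) (M : ℕ) :
    annihilatedProj M y = y := by
  induction M with
  | zero => rfl
  | succ M ih =>
    rw [annihilatedProj, Module.End.mul_apply, phiMode_mul_comm, if_pos (by ring),
      LinearMap.sub_apply, Module.End.mul_apply, hy _ (by lia), map_zero, sub_zero,
      Module.End.one_apply, ih]

/-- The mode φ₍ₖ₎ commutes with the factors φ₍₋₁₋ⱼ₎φ₍ⱼ₎ for j ≠ k and is killed by the one with j =
k, because φ₍ₖ₎² = 0. -/
theorem annihilatedProj_mul_phiMode (k M : ℕ) (h : k < M) : annihilatedProj M * phiMode k = 0 := by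
  induction M with
  | zero => lia
  | succ M ih =>
    rw [annihilatedProj, mul_assoc, mul_assoc]
    by_cases hk : k = M
    · subst hk
      have h2 := phiMode_anticomm k k
      rw [if_neg (by lia), ← two_smul ℂ] at h2
      rw [(smul_eq_zero.mp h2).resolve_left (by norm_num), mul_zero, mul_zero]
    · have hc : phiMode (-1 - M) * (phiMode M * phiMode k)
          = phiMode k * (phiMode (-1 - M) * phiMode M) := by
        rw [phiMode_mul_comm M k, if_neg (by lia), zero_sub, mul_neg, ← mul_assoc,
          phiMode_mul_comm _ k, if_neg (by lia), zero_sub, neg_mul, neg_neg, mul_assoc]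
      rw [hc, ← mul_assoc, ih (by lia), zero_mul]

/-- A vector is a scalar plus finitely many terms e_i · y, and each of the latter is killed once M >
i. -/
theorem exists_annihilatedProj_apply (x : Fock) :
    ∃ M₀ : ℕ, ∀ M, M₀ ≤ M → ∃ c : ℂ, annihilatedProj M x = c • vacuum := by
  induction x using CliffordAlgebra.left_induction with
  | algebraMap r =>
    refine ⟨0, fun M _ => ⟨r, ?_⟩⟩
    rw [Algebra.algebraMap_eq_smul_one, map_smul]
    exact congrArg _ (annihilatedProj_apply_of_annihilated phiMode_vacuum M)
  | add x y hx hy =>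
    obtain ⟨A, hA⟩ := hx
    obtain ⟨B, hB⟩ := hy
    refine ⟨max A B, fun M hM => ?_⟩
    obtain ⟨c, hc⟩ := hA M (by lia)
    obtain ⟨d, hd⟩ := hB M (by lia)
    exact ⟨c + d, by rw [map_add, hc, hd, add_smul]⟩
  | ι_mul x m _ =>
    suffices h : ∃ M₀ : ℕ, ∀ M, M₀ ≤ M → annihilatedProj M (ExteriorAlgebra.ι ℂ m * x) = 0 by
      obtain ⟨A, hA⟩ := h
      exact ⟨A, fun M hM => ⟨0, by rw [zero_smul]; exact hA M hM⟩⟩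
    induction m using Finsupp.induction_linear with
    | zero => exact ⟨0, fun M _ => by rw [map_zero, zero_mul, map_zero]⟩
    | add f g hf hg =>
      obtain ⟨A, hA⟩ := hf
      obtain ⟨B, hB⟩ := hg
      exact ⟨max A B, fun M hM => by
        rw [map_add, add_mul, map_add, hA M (by lia), hB M (by lia), add_zero]⟩
    | single i c =>
      refine ⟨i + 1, fun M hM => ?_⟩
      have h := LinearMap.congr_fun (annihilatedProj_mul_phiMode i M hM) (c • x)
      rw [Module.End.mul_apply, phiMode, if_pos (by lia), LinearMap.mulLeft_apply,
        mul_smul_comm, ← smul_mul_assoc, ← map_smul, Finsupp.smul_single, smul_eq_mul, mul_one,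
        Int.toNat_natCast] at h
      exact h

/-- A vector annihilated by all `φ_n`, `n > 0`, is a multiple of the vacuum. -/
theorem eq_smul_vacuum_of_annihilated {y : Fock} (hy : ∀ k < 0, phiMode k y = 0) :
    y = vacuumFunctional y • vacuum := by
  obtain ⟨M, hM⟩ := exists_annihilatedProj_apply y
  obtain ⟨c, hc⟩ := hM M le_rfl
  rw [annihilatedProj_apply_of_annihilated hy] at hc
  rw [hc, map_smul, vacuumFunctional_vacuum, smul_eq_mul, mul_one]

/-- An operator that commutes up to a sign with all `φ_n` and has no vacuum expectation
vanishes. -/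
theorem eq_zero_of_semicommute {X : Module.End ℂ Fock} {s : ℂ} (hs : s ≠ 0)
    (hX : ∀ k, X * phiMode k = s • (phiMode k * X)) (hv : vacuumFunctional (X vacuum) = 0) :
    X = 0 := by
  -- Annihilators pass through `X` up to the nonzero factor `s`, so `X vacuum` is a multiple of the
  -- vacuum, and the multiple is its vacuum expectation.
  have h0 : X vacuum = 0 := by
    rw [eq_smul_vacuum_of_annihilated (y := X vacuum) fun k hk => ?_, hv, zero_smul]
    have h := LinearMap.congr_fun (hX k) vacuum
    rw [Module.End.mul_apply, phiMode_vacuum k hk, map_zero, LinearMap.smul_apply] at h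
    exact (smul_eq_zero.mp h.symm).resolve_left hs
  have hker : LinearMap.ker X = ⊤ := fock_cyclic _ h0 fun k x hx => by
    have h := LinearMap.congr_fun (hX k) x
    rw [Module.End.mul_apply, LinearMap.smul_apply, Module.End.mul_apply,
      LinearMap.mem_ker.mp hx, map_zero, smul_zero] at h
    exact h
  exact LinearMap.ker_eq_top.mp hker

/-! ### Normal ordered quadratic expressions in the fermion modes -/

/-- The summand `f(i) :φ₍ᵢ₎ φ₍ₙ₋ᵢ₎:` with the normal ordering cut at `K`. -/
def quadTerm (K n : ℤ) (f : ℤ → ℂ) (i : ℤ) : Module.End ℂ Fock :=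
  if K ≤ i then f i • (phiMode i * phiMode (n - i)) else -(f i • (phiMode (n - i) * phiMode i))

theorem quadTerm_support_finite (n : ℤ) (f : ℤ → ℂ) (v : Fock) :
    (Function.support fun i => quadTerm 0 n f i v).Finite := by
  refine (normalTerm_support_finite 1 1 phi phi n v).subset fun i hi hz => hi ?_
  have : quadTerm 0 n f i = f i • normalTerm 1 1 phi phi n i := by
    unfold quadTerm normalTerm
    simp only [phi, coeff_mkField]
    split_ifs
    · rfl
    · simp
  show quadTerm 0 n f i v = 0
  rw [this, LinearMap.smul_apply, show normalTerm 1 1 phi phi n i v = 0 from hz, smul_zero]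

/-- `∑ᵢ f(i) :φ₍ᵢ₎ φ₍ₙ₋ᵢ₎:`, where `φ₍ᵢ₎` is the coefficient of `φ(z)` at `z ^ i`. -/
def quad (n : ℤ) (f : ℤ → ℂ) : Module.End ℂ Fock :=
  (LocSum.exists_of_finite (quadTerm_support_finite n f)).choose

theorem locSum_quad (n : ℤ) (f : ℤ → ℂ) : LocSum (quadTerm 0 n f) (quad n f) :=
  (LocSum.exists_of_finite (quadTerm_support_finite n f)).choose_spec

theorem locSum_quad_cutoff (n : ℤ) (f G : ℤ → ℂ) (hG : n = -1 → ∀ i, G (i + 1) - G i = f i)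
    (K : ℤ) : LocSum (quadTerm K n f)
      (quad n f - (if n = -1 then G K - G 0 else 0) • (1 : Module.End ℂ Fock)) := by
  refine (LocSum.cutoff (G := G) (C := if n = -1 then 1 else 0) (fun i => ?_)
    (locSum_quad n f) K).congr (fun _ => rfl) ?_
  · rw [sub_neg_eq_add, ← smul_add, phiMode_anticomm]
    by_cases hn : n = -1
    · rw [if_pos (by lia), if_pos hn, hG hn]
    · rw [if_neg (by lia), if_neg hn, smul_zero, smul_zero]
  · split_ifs <;> simp

theorem quad_add (n : ℤ) (f g : ℤ → ℂ) : quad n (fun i => f i + g i) = quad n f + quad n g :=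
  (locSum_quad n _).unique (((locSum_quad n f).add (locSum_quad n g)).congr (fun i => by
    unfold quadTerm
    split_ifs <;> module) rfl)

theorem quad_smul (n : ℤ) (c : ℂ) (f : ℤ → ℂ) : quad n (fun i => c * f i) = c • quad n f :=
  (locSum_quad n _).unique (((locSum_quad n f).smul c).congr (fun i => by
    unfold quadTerm
    split_ifs <;> module) rfl)

/-- Normal ordered products are antisymmetric under i ↔ n - i, so symmetric weights cancel. When i
and n - i lie on the same side of the cut, n ≠ -1 and the two modes anticommute. -/
theorem quad_eq_zero (n : ℤ) (f : ℤ → ℂ) (hf : ∀ i, f (n - i) = f i) : quad n f = 0 := by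
  have h := ((locSum_quad n f).comp_equiv (Equiv.subLeft n)).unique
    ((locSum_quad n f).neg.congr (fun i => ?_) rfl)
  · rw [eq_neg_iff_add_eq_zero, ← two_smul ℂ] at h
    exact (smul_eq_zero.mp h).resolve_left (by norm_num)
  · simp only [Equiv.subLeft_apply]
    unfold quadTerm
    rw [sub_sub_cancel, hf]
    by_cases h1 : 0 ≤ i <;> by_cases h2 : 0 ≤ n - i
    · rw [if_pos h1, if_pos h2, phiMode_mul_comm, if_neg (by lia)]
      module
    · rw [if_pos h1, if_neg h2]
    · rw [if_neg h1, if_pos h2, neg_neg]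
    · rw [if_neg h1, if_neg h2, phiMode_mul_comm, if_neg (by lia)]
      module

/-- Only the antisymmetric part of the weights matters. -/
theorem quad_congr (n : ℤ) (f g : ℤ → ℂ) (h : ∀ i, f i - f (n - i) = g i - g (n - i)) :
    quad n f = quad n g := by
  have h0 := quad_eq_zero n (fun i => f i + -1 * g i) fun i => by linear_combination -h i
  rw [quad_add, quad_smul] at h0
  refine sub_eq_zero.mp ((Eq.symm ?_).trans h0)
  module

/-- The commutator of a quadratic expression with a fermion mode. -/
theorem quad_mul_phiMode (n : ℤ) (f : ℤ → ℂ) (k : ℤ) :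
    quad n f * phiMode k - phiMode k * quad n f
      = (f (n + 1 + k) - f (-1 - k)) • phiMode (n + 1 + k) := by
  refine (((locSum_quad n f).mul_right (phiMode k)).sub
    ((locSum_quad n f).mul_left (phiMode k))).unique
    (((LocSum.single (n + 1 + k) fun i => f i • phiMode i).sub
      (LocSum.single (-1 - k) fun i => f i • phiMode (n - i))).congr (fun i => ?_) ?_)
  · have h1 : phiMode (n - i) * phiMode k + phiMode k * phiMode (n - i)
        = if i = n + 1 + k then 1 else 0 :=
      (phiMode_anticomm _ _).trans (if_congr (by lia) rfl rfl)
    have h2 : phiMode i * phiMode k + phiMode k * phiMode i = if i = -1 - k then 1 else 0 :=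
      (phiMode_anticomm _ _).trans (if_congr (by lia) rfl rfl)
    have h3 := congrArg (fun X => phiMode i * X) h1
    have h4 := congrArg (fun X => X * phiMode (n - i)) h2
    have h5 := congrArg (fun X => phiMode (n - i) * X) h2
    have h6 := congrArg (fun X => X * phiMode i) h1
    simp only [mul_add, add_mul, mul_ite, ite_mul, mul_one, one_mul, mul_zero, zero_mul,
      mul_assoc] at h3 h4 h5 h6
    have e3 : (if i = n + 1 + k then f i • phiMode i else 0)
      = f i • (if i = n + 1 + k then phiMode i else 0) := by rw [smul_ite, smul_zero]
    have e4 : (if i = -1 - k then f i • phiMode (n - i) else 0)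
      = f i • (if i = -1 - k then phiMode (n - i) else 0) := by rw [smul_ite, smul_zero]
    rw [e3, e4]
    by_cases hi : 0 ≤ i
    · rw [quadTerm, if_pos hi, ← h3, ← h4]
      simp only [smul_mul_assoc, mul_smul_comm, mul_assoc]
      module
    · rw [quadTerm, if_neg hi, ← h5, ← h6]
      simp only [smul_mul_assoc, mul_smul_comm, neg_mul, mul_neg, mul_assoc]
      module
  · rw [show n - (-1 - k) = n + 1 + k by ring]
    module

/-- The commutator of a quadratic expression with an operator that acts on the fermion modes
by shifts. -/
theorem commutator_quad {A : Module.End ℂ Fock} {m : ℤ} {γ : ℤ → ℂ}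
    (hA : ∀ k, A * phiMode k - phiMode k * A = γ k • phiMode (m + 1 + k))
    (n : ℤ) (f G : ℤ → ℂ)
    (hG : m + 1 + n = -1 → ∀ i, G (i + 1) - G i = f (i - (m + 1)) * γ (i - (m + 1))) :
    A * quad n f - quad n f * A
      = quad (m + 1 + n) (fun i => f (i - (m + 1)) * γ (i - (m + 1)) + f i * γ (n - i))
        - (if m + 1 + n = -1 then G (m + 1) - G 0 else 0) • (1 : Module.End ℂ Fock) := by
  have h1 := (locSum_quad_cutoff (m + 1 + n)
    (fun i => f (i - (m + 1)) * γ (i - (m + 1))) G hG (m + 1)).comp_equiv (Equiv.addRight (m + 1))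
  have h2 := locSum_quad (m + 1 + n) (fun i => f i * γ (n - i))
  refine (((locSum_quad n f).mul_left A).sub ((locSum_quad n f).mul_right A)).unique
    ((h1.add h2).congr (fun i => ?_) ?_)
  · have a1 := congrArg (fun X => X * phiMode (n - i)) (hA i)
    have a2 := congrArg (fun X => phiMode i * X) (hA (n - i))
    have a3 := congrArg (fun X => X * phiMode i) (hA (n - i))
    have a4 := congrArg (fun X => phiMode (n - i) * X) (hA i)
    simp only [sub_mul, mul_sub, mul_assoc, smul_mul_assoc, mul_smul_comm] at a1 a2 a3 a4
    have e : i + (m + 1) = m + 1 + i := by ring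
    have e' : m + 1 + n - i = m + 1 + (n - i) := by ring
    simp only [quadTerm, Equiv.coe_addRight, add_sub_cancel_right]
    rw [show m + 1 + n - (i + (m + 1)) = n - i by ring, e, e']
    by_cases hi : 0 ≤ i
    · rw [if_pos (by lia), if_pos hi, if_pos hi, mul_smul_comm, smul_mul_assoc, mul_smul, mul_smul,
        ← a1, ← a2, mul_assoc]
      module
    · rw [if_neg (by lia), if_neg hi, if_neg hi, mul_smul, mul_smul, ← a3, ← a4]
      refine Eq.trans ?_ (mul_neg_sub_neg_mul A _).symm
      rw [mul_smul_comm, smul_mul_assoc, mul_assoc]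
      module
  · rw [quad_add]
    abel

theorem quad_vacuum (n : ℤ) (hn : n < 0) (f : ℤ → ℂ) : quad n f vacuum = 0 := by
  rw [← (locSum_quad n f vacuum).2]
  refine finsum_eq_zero_of_forall_eq_zero fun i => ?_
  unfold quadTerm
  split_ifs with h
  · rw [LinearMap.smul_apply, Module.End.mul_apply, phiMode_vacuum (n - i) (by lia), map_zero,
      smul_zero]
  · rw [LinearMap.neg_apply, LinearMap.smul_apply, Module.End.mul_apply,
      phiMode_vacuum i (by lia), map_zero, smul_zero, neg_zero]

theorem LocSum.vacuumFunctional_eq_zero {ι : Type*} {X : ι → Module.End ℂ Fock}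
    {T : Module.End ℂ Fock} (h : LocSum X T) {v : Fock}
    (hX : ∀ j, vacuumFunctional (X j v) = 0) : vacuumFunctional (T v) = 0 := by
  rw [← (h v).2, ← LinearMap.toAddMonoidHom_coe, AddMonoidHom.map_finsum _ (h v).1]
  simp only [LinearMap.toAddMonoidHom_coe, hX, finsum_zero]

theorem vacuumFunctional_quad (n : ℤ) (hn : 0 ≤ n) (f : ℤ → ℂ) (v : Fock) :
    vacuumFunctional (quad n f v) = 0 := by
  refine (locSum_quad n f).vacuumFunctional_eq_zero fun i => ?_
  unfold quadTerm
  split_ifs with h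
  · rw [LinearMap.smul_apply, Module.End.mul_apply, map_smul, vacuumFunctional_phiMode i h,
      smul_zero]
  · rw [LinearMap.neg_apply, LinearMap.smul_apply, Module.End.mul_apply, map_neg, map_smul,
      vacuumFunctional_phiMode _ (by lia), smul_zero, neg_zero]

/-! ### The fields as quadratic expressions in the fermion modes -/

/-- The sign `(-1)^i` as a complex number. -/
def altSign (i : ℤ) : ℂ := (-1) ^ i

theorem altSign_add (i j : ℤ) : altSign (i + j) = altSign i * altSign j :=
  zpow_add₀ (by norm_num) i j

theorem altSign_neg (i : ℤ) : altSign (-i) = altSign i := by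
  rw [altSign, zpow_neg, ← inv_zpow, inv_neg_one, altSign]

theorem altSign_sub (i j : ℤ) : altSign (i - j) = altSign i * altSign j := by
  rw [sub_eq_add_neg, altSign_add, altSign_neg]

theorem altSign_zero : altSign 0 = 1 := zpow_zero _

theorem altSign_one : altSign 1 = -1 := zpow_one _

theorem altSign_mul_self (i : ℤ) : altSign i * altSign i = 1 := by
  rw [← altSign_sub, sub_self, altSign_zero]

theorem altSign_two_mul (i : ℤ) : altSign (2 * i) = 1 := by
  rw [two_mul, altSign_add, altSign_mul_self]

theorem coeff_reflect {V : Type*} [AddCommGroup V] [Module ℂ V] (a : VertexOperator ℂ V) (k : ℤ) :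
    coeff (reflect a) k = altSign k • coeff a k := rfl

theorem coeff_fieldDeriv {V : Type*} [AddCommGroup V] [Module ℂ V] (a : VertexOperator ℂ V)
    (k : ℤ) : coeff (fieldDeriv a) k = ((k : ℂ) + 1) • coeff a (k + 1) := rfl

theorem coeff_zMul {V : Type*} [AddCommGroup V] [Module ℂ V] (d : ℤ) (a : VertexOperator ℂ V)
    (k : ℤ) : coeff (zMul d a) k = coeff a (k - d) := rfl

theorem coeff_idField {V : Type*} [AddCommGroup V] [Module ℂ V] (k : ℤ) :
    coeff (idField V) k = if k = 0 then 1 else 0 := rfl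

theorem coeff_phi (k : ℤ) : coeff phi k = phiMode k := rfl

theorem field_ext {V : Type*} [AddCommGroup V] [Module ℂ V] {a b : VertexOperator ℂ V}
    (h : ∀ k, coeff a k = coeff b k) : a = b :=
  coeff_inj (funext h)

theorem coeff_normalOrder_reflect {V : Type*} [AddCommGroup V] [Module ℂ V] (p q : ℕ)
    (a b : VertexOperator ℂ V) (k : ℤ) :
    coeff (normalOrder p q (reflect a) (reflect b)) k
      = altSign k • coeff (normalOrder p q a b) k := by
  refine (locSum_normalOrder p q (reflect a) (reflect b) k).unique
    (((locSum_normalOrder p q a b k).smul (altSign k)).congr (fun j => ?_) rfl)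
  have h : altSign k = altSign j * altSign (k - j) := by
    rw [← altSign_add, add_sub_cancel]
  unfold normalTerm
  rw [coeff_reflect, coeff_reflect, h]
  split_ifs
  · rw [smul_mul_smul_comm]
  · rw [smul_mul_smul_comm, smul_comm, mul_comm (altSign j)]

theorem coeff_normalOrder_deriv_phi (k : ℤ) :
    coeff (normalOrder 1 1 (fieldDeriv phi) phi) k = quad (k + 1) (fun i => (i : ℂ)) := by
  refine (locSum_normalOrder 1 1 (fieldDeriv phi) phi k).unique
    (((locSum_quad (k + 1) fun i => (i : ℂ)).comp_equiv (Equiv.addRight 1)).congr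
      (fun j => ?_) rfl)
  simp only [quadTerm, normalTerm, Equiv.coe_addRight, coeff_fieldDeriv, coeff_phi,
    show k + 1 - (j + 1) = k - j by ring]
  -- The shift by 1 separates the two cuts only at j = -1, where both coefficients vanish, so no
  -- scalar appears.
  rcases lt_trichotomy j (-1) with hj | rfl | hj
  · rw [if_neg (by lia), if_neg (by lia), mul_smul_comm]
    push_cast
    module
  · simp
  · rw [if_pos (by lia), if_pos (by lia), smul_mul_assoc]
    push_cast
    rfl

theorem coeff_heis (k : ℤ) : coeff heis k = quad k (fun i => 1 / 2 * altSign (k - i)) := by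
  rw [quad_smul, heis, map_smul, Pi.smul_apply]
  congr 1
  refine (locSum_normalOrder 1 1 phi (reflect phi) k).unique
    ((locSum_quad k fun i => altSign (k - i)).congr (fun j => ?_) rfl)
  simp only [quadTerm, normalTerm, coeff_reflect, coeff_phi]
  split_ifs
  · rw [mul_smul_comm]
  · rw [smul_mul_assoc]
    module

theorem coeff_heis_eq_zero (k : ℤ) (hk : 2 ∣ k) : coeff heis k = 0 := by
  obtain ⟨k, rfl⟩ := hk
  rw [coeff_heis]
  refine quad_eq_zero _ _ fun i => ?_
  simp only [altSign_sub, altSign_two_mul, one_mul]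

/-- The factor 1 - (-1)ⁿ reflects that only odd coefficients of h survive. -/
theorem coeff_heis_mul_phiMode (n k : ℤ) :
    coeff heis n * phiMode k - phiMode k * coeff heis n
      = (-1 / 2 * altSign k * (1 - altSign n)) • phiMode (n + 1 + k) := by
  rw [coeff_heis, quad_mul_phiMode]
  congr 1
  simp only [altSign_sub, altSign_add, altSign_neg, altSign_one]
  linear_combination (-1 / 2 * altSign k) * altSign_mul_self n

theorem coeff_LHalf (k : ℤ) : coeff LHalf k = quad (k + 1) (fun i => 1 / 2 * (i : ℂ)) := by
  rw [quad_smul, ← coeff_normalOrder_deriv_phi]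
  rfl

theorem LHalfTilde_eq : LHalfTilde = reflect LHalf := by
  refine field_ext fun k => ?_
  rw [coeff_reflect, LHalfTilde, LHalf, map_smul, map_smul, Pi.smul_apply, Pi.smul_apply,
    coeff_normalOrder_reflect, smul_comm]

theorem sub_smul_eq_add_neg_smul {V : Type*} [AddCommGroup V] [Module ℂ V] (c : ℂ)
    (X Y : Module.End ℂ V) : X - c • Y = X + (-c) • Y := by
  rw [neg_smul, sub_eq_add_neg]

/-- The commutator of two quadratic expressions. -/
theorem quad_commutator (m n : ℤ) (g f G : ℤ → ℂ) (hG : m + 1 + n = -1 → ∀ i, G (i + 1) - G i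
      = f (i - (m + 1)) * (g i - g (m - i))) :
    quad m g * quad n f - quad n f * quad m g
      = quad (m + 1 + n) (fun i => f (i - (m + 1)) * (g i - g (m - i))
          + f i * (g (m + 1 + n - i) - g (i - 1 - n)))
        + (if m + 1 + n = -1 then G 0 - G (m + 1) else 0) • (1 : Module.End ℂ Fock) := by
  have h := commutator_quad (quad_mul_phiMode m g) n f G (fun hmn i => by
    rw [hG hmn, show m + 1 + (i - (m + 1)) = i by ring, show -1 - (i - (m + 1)) = m - i by ring])
  refine (h.trans (sub_smul_eq_add_neg_smul _ _ _)).trans ?_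
  rw [apply_ite Neg.neg, neg_zero, neg_sub]
  congr 2
  funext i
  rw [show m + 1 + (i - (m + 1)) = i by ring, show -1 - (i - (m + 1)) = m - i by ring,
    show m + 1 + (n - i) = m + 1 + n - i by ring, show -1 - (n - i) = i - 1 - n by ring]

/-! ### Virasoro and Heisenberg commutators of the quadratic modes -/

theorem hasVirasoroModes_LHalf : HasVirasoroModes 1 (1 / 2) LHalf := by
  refine ⟨fun k hk => (hk (by simp)).elim, fun m n => ?_⟩
  simp only [coeff_LHalf, Nat.cast_one, one_mul]
  -- The function supplied is the discrete antiderivative of (i + m)(2i + m + 1)/4 = (2i² + (3m +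
  -- 1)i + m(m + 1))/4.
  rw [show -m - 2 + 1 = -m - 1 by ring, show -n - 2 + 1 = -n - 1 by ring,
    show -(m + n) - 2 + 1 = -m - 1 + 1 + (-n - 1) by ring,
    quad_commutator (-m - 1) (-n - 1) _ _ (fun i => ((i : ℂ) * (i - 1) * (2 * i - 1) / 3
      + (3 * m + 1) * (i * (i - 1) / 2) + m * (m + 1) * i) / 4) (fun _ i => by push_cast; ring),
    ← quad_smul]
  congr 1
  · refine quad_congr _ _ _ fun i => ?_
    push_cast
    ring
  · congr 1
    by_cases hmn : m = -n
    · rw [if_pos (by lia), if_pos hmn]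
      push_cast
      ring
    · rw [if_neg (by lia), if_neg hmn]

/-- The coefficient of `¼ z⁻² :∂φ(z) φ(z):` at `z ^ (-2n-4)`. -/
def quarterMode (n : ℤ) : Module.End ℂ Fock := quad (-2 * n - 1) (fun i => 1 / 4 * (i : ℂ))

/-- The mode `h_n` of the Heisenberg field `h(z) = ∑ h_n z^(-2n-1)`. -/
def heisMode (n : ℤ) : Module.End ℂ Fock := coeff heis (-2 * n - 1)

theorem heisMode_eq (n : ℤ) :
    heisMode n = quad (-2 * n - 1) (fun i => -1 / 2 * altSign i) := by
  rw [heisMode, coeff_heis]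
  congr 1
  funext i
  rw [altSign_sub, show -2 * n - 1 = 2 * (-n) - 1 by ring, altSign_sub, altSign_two_mul,
    altSign_one]
  ring

/-- The central term differs from (m³ - m)/12 by m/16 = 2m · 1/32, which is the origin of the
constant 1/(32z⁴). -/
theorem quarterMode_commutator (m n : ℤ) :
    quarterMode m * quarterMode n - quarterMode n * quarterMode m
      = ((m : ℂ) - n) • quarterMode (m + n)
        + (if m = -n then (m : ℂ) ^ 3 / 12 - m / 48 else 0) • (1 : Module.End ℂ Fock) := by
  rw [quarterMode, quarterMode, quarterMode,
    quad_commutator (-2 * m - 1) (-2 * n - 1) _ _ (fun i => ((i : ℂ) * (i - 1) * (2 * i - 1) / 3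
      + (6 * m + 1) * (i * (i - 1) / 2) + 2 * m * (2 * m + 1) * i) / 16)
      (fun _ i => by push_cast; ring),
    ← quad_smul,
    show -2 * (m + n) - 1 = -2 * m - 1 + 1 + (-2 * n - 1) by ring]
  congr 1
  · refine quad_congr _ _ _ fun i => ?_
    push_cast
    ring
  · congr 1
    by_cases hmn : m = -n
    · rw [if_pos (by lia), if_pos hmn]
      push_cast
      ring
    · rw [if_neg (by lia), if_neg hmn]

theorem altSign_neg_two_mul (m : ℤ) : altSign (-2 * m) = 1 := by
  rw [neg_mul, altSign_neg, altSign_two_mul]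

/-- The anomaly m/4 would be absorbed by replacing h₀ with h₀ + ¼. The weights are linear times
(-1)ⁱ, and so is their antiderivative. -/
theorem quarterMode_heisMode_commutator (m n : ℤ) :
    quarterMode m * heisMode n - heisMode n * quarterMode m
      = (-(n : ℂ)) • heisMode (m + n)
        + (if m = -n then (m : ℂ) / 4 else 0) • (1 : Module.End ℂ Fock) := by
  rw [quarterMode, heisMode_eq, heisMode_eq,
    quad_commutator (-2 * m - 1) (-2 * n - 1) _ _
      (fun i => -1 / 2 * ((-(i : ℂ) / 4 + 1 / 8 - (2 * m + 1) / 8) * altSign i))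
      (fun _ i => by
        simp only [altSign_sub, altSign_add, altSign_one, altSign_neg_two_mul]
        push_cast
        ring),
    ← quad_smul,
    show -2 * (m + n) - 1 = -2 * m - 1 + 1 + (-2 * n - 1) by ring]
  congr 1
  · refine quad_congr _ _ _ fun i => ?_
    simp only [altSign_sub, altSign_add, altSign_one, altSign_neg_two_mul]
    push_cast
    ring
  · congr 1
    by_cases hmn : m = -n
    · rw [if_pos (by lia), if_pos hmn]
      simp only [altSign_sub, altSign_add, altSign_one, altSign_neg_two_mul, altSign_zero]
      push_cast
      ring
    · rw [if_neg (by lia), if_neg hmn]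

theorem heisMode_commutator (m n : ℤ) :
    heisMode m * heisMode n - heisMode n * heisMode m
      = (if m = -n then (m : ℂ) else 0) • (1 : Module.End ℂ Fock) := by
  rw [heisMode_eq, heisMode_eq, quad_commutator (-2 * m - 1) (-2 * n - 1) _ _
      (fun i => (i : ℂ) / 2) (fun _ i => by
        simp only [altSign_sub, altSign_add, altSign_one, altSign_neg_two_mul]
        push_cast
        linear_combination (-1 / 2) * altSign_mul_self i),
    quad_eq_zero, zero_add]
  · congr 1
    by_cases hmn : m = -n
    · rw [if_pos (by lia), if_pos hmn]
      push_cast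
      ring
    · rw [if_neg (by lia), if_neg hmn]
  · intro i
    simp only [altSign_sub, altSign_add, altSign_one, altSign_neg_two_mul]
    ring

/-- A combination of Heisenberg and quadratic modes that satisfies the Virasoro relations. -/
theorem modes_commutator (a b : ℂ) (m n : ℤ) (A : ℤ → Module.End ℂ Fock)
    (hA : ∀ n, A n = quarterMode n + (-1 / 4 - a * n - a / 2 - b) • heisMode n
      + (if n = 0 then (16 * b ^ 2 + 16 * a * b - 12 * a ^ 2) / 32 else 0) • 1) :
    A m * A n - A n * A m = ((m : ℂ) - n) • A (m + n)
      + (if m = -n then ((m : ℂ) ^ 3 - m) / 12 * (1 - 12 * a ^ 2) else 0) • 1 := by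
  have h1 := quarterMode_commutator m n
  have h2 := quarterMode_heisMode_commutator m n
  have h3 := quarterMode_heisMode_commutator n m
  have h4 := heisMode_commutator m n
  rw [hA, hA, hA]
  generalize (if m = 0 then (16 * b ^ 2 + 16 * a * b - 12 * a ^ 2) / 32 else 0) = u
  generalize (if n = 0 then (16 * b ^ 2 + 16 * a * b - 12 * a ^ 2) / 32 else 0) = v
  generalize hx' : (-1 / 4 - a * m - a / 2 - b) = x
  generalize hy' : (-1 / 4 - a * n - a / 2 - b) = y
  -- The scalar parts `u`, `v` drop out of the commutator; the constant matters only through `A (m +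
  -- n)` on the right.
  have key : ∀ T T' H H' : Module.End ℂ Fock,
      (T + x • H + u • 1) * (T' + y • H' + v • 1) - (T' + y • H' + v • 1) * (T + x • H + u • 1)
        = (T * T' - T' * T) + y • (T * H' - H' * T) - x • (T' * H - H * T')
          + (x * y) • (H * H' - H' * H) := by
    intro T T' H H'
    simp only [mul_add, add_mul, smul_mul_assoc, mul_smul_comm, mul_one, one_mul]
    module
  rw [key, h1, h2, h3, h4, add_comm n m, ← hx', ← hy']
  by_cases hmn : m = -n
  · subst hmn
    simp only [if_true, neg_neg, neg_add_cancel]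
    push_cast
    module
  · rw [if_neg hmn, if_neg hmn, if_neg (by lia), if_neg hmn, if_neg hmn, if_neg (by lia)]
    push_cast
    module

/-! ### The normal ordered square of the Heisenberg field -/

theorem vacuumFunctional_phiMode_vacuum (k : ℤ) : vacuumFunctional (phiMode k vacuum) = 0 := by
  by_cases hk : 0 ≤ k
  · exact vacuumFunctional_phiMode k hk vacuum
  · rw [phiMode_vacuum k (by lia), map_zero]

theorem vacuumFunctional_quad_vacuum (n : ℤ) (f : ℤ → ℂ) :
    vacuumFunctional (quad n f vacuum) = 0 := by
  by_cases hn : 0 ≤ n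
  · exact vacuumFunctional_quad n hn f vacuum
  · rw [quad_vacuum n (by lia), map_zero]

/-- The normal ordered product `:h(z)a(z):` has no vacuum expectation. -/
theorem vacuumFunctional_normalOrder_heis (p : ℕ) (a : VertexOperator ℂ Fock) (n : ℤ) :
    vacuumFunctional (coeff (normalOrder 0 p heis a) n vacuum) = 0 := by
  refine (locSum_normalOrder 0 p heis a n).vacuumFunctional_eq_zero fun j => ?_
  unfold normalTerm
  rw [coeff_heis]
  split_ifs with hj
  · rw [Module.End.mul_apply, vacuumFunctional_quad j hj]
  · rw [LinearMap.smul_apply, Module.End.mul_apply, quad_vacuum j (by lia), map_zero, smul_zero,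
      map_zero]

/-- From {hφ, φ₍ₖ₎} = h{φ, φ₍ₖ₎} - [h, φ₍ₖ₎]φ one gets a single mode of h and a quadratic sum with
cut at k + 1. The quadratic parts cancel, and moving the cut leaves the scalar. -/
theorem normalOrder_heis_phi_anticomm (q k : ℤ) :
    coeff (normalOrder 0 1 heis phi) q * phiMode k + phiMode k * coeff (normalOrder 0 1 heis phi) q
      = (1 / 2 * altSign q * (q + 1) - 1 / 4 * altSign q - 1 / 4) •
        (if q + 1 + k = -1 then (1 : Module.End ℂ Fock) else 0) := by
  have hU := locSum_normalOrder 0 1 heis phi q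
  have hQ := (locSum_quad_cutoff (q + 1 + k) (fun i => 1 / 2 * (altSign k + altSign i))
    (fun i => 1 / 2 * altSign k * i - 1 / 4 * altSign i) (fun _ i => by
      rw [altSign_add, altSign_one]
      push_cast
      ring) (k + 1)).comp_equiv (Equiv.addRight (k + 1))
  refine ((hU.mul_right (phiMode k)).add (hU.mul_left (phiMode k))).unique
    (((LocSum.single (q + 1 + k) fun i => coeff heis i).add hQ).congr (fun j => ?_) ?_)
  · have h1 : phiMode (q - j) * phiMode k + phiMode k * phiMode (q - j)
        = if j = q + 1 + k then 1 else 0 :=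
      (phiMode_anticomm _ _).trans (if_congr (by lia) rfl rfl)
    have h2 := coeff_heis_mul_phiMode j k
    have h3 := congrArg (fun X => coeff heis j * X) h1
    have h4 := congrArg (fun X => X * coeff heis j) h1
    simp only [mul_add, add_mul, mul_ite, ite_mul, mul_one, one_mul, mul_zero, zero_mul,
      mul_assoc] at h3 h4
    have hs : 1 / 2 * (altSign k + altSign (j + 1 + k))
        = -(-1 / 2 * altSign k * (1 - altSign j)) := by
      rw [altSign_add, altSign_add, altSign_one]
      ring
    have e1 : j + (k + 1) = j + 1 + k := by ring
    have e2 : q + 1 + k - (j + 1 + k) = q - j := by ring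
    simp only [quadTerm, normalTerm, Equiv.coe_addRight, coeff_phi, e1, e2, hs, zero_mul, pow_zero,
      one_smul]
    by_cases hj : 0 ≤ j
    · simp only [if_pos hj, if_pos (show k + 1 ≤ j + 1 + k by lia)]
      rw [neg_smul, ← h3, ← smul_mul_assoc, ← h2, sub_mul]
      simp only [mul_assoc]
      abel
    · simp only [if_neg hj, if_neg (show ¬ k + 1 ≤ j + 1 + k by lia)]
      rw [neg_smul, neg_neg, ← h4, ← mul_smul_comm, ← h2, mul_sub]
      simp only [mul_assoc]
      abel
  -- The weights of the two contributions add up to a symmetric function of the index.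
  · have hz := quad_eq_zero (q + 1 + k)
      (fun i => 1 / 2 * altSign (q + 1 + k - i) + 1 / 2 * (altSign k + altSign i)) fun i => by
        rw [sub_sub_cancel]
        ring
    rw [quad_add, ← coeff_heis] at hz
    rw [← add_sub_assoc, hz]
    by_cases h : q + 1 + k = -1
    · rw [if_pos h, if_pos h, zero_sub]
      obtain rfl : k = -q - 2 * 1 := by lia
      simp only [altSign_add, altSign_sub, altSign_neg, altSign_one, altSign_zero,
        altSign_two_mul]
      push_cast
      module
    · rw [if_neg h, if_neg h]
      module

/-- In terms of fields, :hφ: = ½(∂φ)(-z) + ¼z⁻¹(φ(-z) - φ(z)). Both sides have the same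
anticommutators with all φ₍ₖ₎ and zero vacuum expectation. -/
theorem coeff_normalOrder_heis_phi (q : ℤ) :
    coeff (normalOrder 0 1 heis phi) q
      = (1 / 2 * altSign q * (q + 1) - 1 / 4 * altSign q - 1 / 4) • phiMode (q + 1) := by
  refine sub_eq_zero.mp (eq_zero_of_semicommute (s := -1) (by norm_num) (fun k => ?_) ?_)
  · have h := normalOrder_heis_phi_anticomm q k
    rw [← phiMode_anticomm (q + 1) k] at h
    rw [neg_one_smul, eq_neg_iff_add_eq_zero, sub_mul, mul_sub, smul_mul_assoc, mul_smul_comm,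
      sub_add_sub_comm, h, smul_add, sub_self]
  · rw [LinearMap.sub_apply, map_sub, vacuumFunctional_normalOrder_heis, LinearMap.smul_apply,
      map_smul, vacuumFunctional_phiMode_vacuum, smul_zero, sub_zero]

theorem altSign_of_not_two_dvd {j : ℤ} (hj : ¬ 2 ∣ j) : altSign j = -1 := by
  obtain ⟨i, rfl⟩ : ∃ i, j = 2 * i + 1 := ⟨j / 2, by lia⟩
  rw [altSign_add, altSign_two_mul, altSign_one, one_mul]

/-- Lets the sign (-1)ʲ be replaced by -1 in front of h₍ⱼ₎, which makes the coefficients below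
independent of the summation index. -/
theorem smul_coeff_heis (c : ℂ → ℂ) (j : ℤ) :
    c (altSign j) • coeff heis j = c (-1) • coeff heis j := by
  by_cases hj : 2 ∣ j
  · rw [coeff_heis_eq_zero j hj, smul_zero, smul_zero]
  · rw [altSign_of_not_two_dvd hj]

/-- By the Leibniz rule each of the two factors h contributes a copy of :hφ:. In the second copy the
index is reflected, j ↦ n - j, which puts its cut at n + 1; the subtracted multiple of a fermion
mode corrects for that. -/
theorem normalOrder_heis_heis_commutator (n k : ℤ) :
    coeff (normalOrder 0 0 heis heis) n * phiMode k
        - phiMode k * coeff (normalOrder 0 0 heis heis) n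
      = (-1 / 2 * altSign k * (1 + altSign n)) • (coeff (normalOrder 0 1 heis phi) (n + 1 + k)
          + (coeff (normalOrder 0 1 heis phi) (n + 1 + k)
            - (1 / 2 * altSign (n + 1 + k) * (n + 1 / 2 - 1 / 2 * altSign n)) •
              phiMode (n + 1 + k + 1))) := by
  have hU := locSum_normalOrder 0 1 heis phi (n + 1 + k)
  have hY := (LocSum.cutoff (A := fun i => coeff heis i * phiMode (n + 1 + k - i))
    (B := fun i => phiMode (n + 1 + k - i) * coeff heis i) (C := phiMode (n + 1 + k + 1))
    (G := fun i => 1 / 2 * altSign (n + 1 + k) * (i + 1 / 2 * altSign i)) (fun i => by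
      rw [coeff_heis_mul_phiMode, show i + 1 + (n + 1 + k - i) = n + 1 + k + 1 by ring,
        altSign_sub _ i, altSign_add i, altSign_one]
      congr 1
      push_cast
      linear_combination 1 / 2 * altSign (n + 1 + k) * altSign_mul_self i)
    (hU.congr (fun i => by
      simp only [normalTerm, coeff_phi, zero_mul, pow_zero, one_smul]) rfl) (n + 1)).comp_equiv
      (Equiv.subLeft n)
  have hR := locSum_normalOrder 0 0 heis heis n
  refine ((hR.mul_right (phiMode k)).sub (hR.mul_left (phiMode k))).unique
    (((hU.add hY).smul (-1 / 2 * altSign k * (1 + altSign n))).congr (fun j => ?_) ?_)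
  · have h1 := coeff_heis_mul_phiMode j k
    have h2 := coeff_heis_mul_phiMode (n - j) k
    have c1 : (-1 / 2 * altSign k * (1 - altSign (n - j))) • coeff heis j
        = (-1 / 2 * altSign k * (1 + altSign n)) • coeff heis j := by
      rw [altSign_sub]
      refine (smul_coeff_heis (fun x => -1 / 2 * altSign k * (1 - altSign n * x)) j).trans ?_
      congr 1
      ring
    have c2 : (-1 / 2 * altSign k * (1 - altSign j)) • coeff heis (n - j)
        = (-1 / 2 * altSign k * (1 + altSign n)) • coeff heis (n - j) := by
      have hj : altSign j = altSign n * altSign (n - j) := by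
        rw [← altSign_sub, sub_sub_cancel]
      rw [hj]
      refine (smul_coeff_heis (fun x => -1 / 2 * altSign k * (1 - altSign n * x)) (n - j)).trans ?_
      congr 1
      ring
    have e1 : n + 1 + k - j = n - j + 1 + k := by ring
    have e2 : n + 1 + k - (n - j) = j + 1 + k := by ring
    simp only [normalTerm, Equiv.subLeft_apply, coeff_phi, e1, e2, zero_mul, pow_zero, one_smul]
    rw [smul_add]
    by_cases hj : 0 ≤ j
    · rw [if_pos hj, if_pos hj, if_neg (by lia), ← smul_mul_assoc, ← mul_smul_comm, ← c1, ← c2,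
        smul_mul_assoc, mul_smul_comm, ← mul_smul_comm, ← smul_mul_assoc, ← h1, ← h2]
      simp only [mul_sub, sub_mul, mul_assoc]
      abel
    · rw [if_neg hj, if_neg hj, if_pos (by lia), ← mul_smul_comm, ← smul_mul_assoc, ← c1, ← c2,
        mul_smul_comm, smul_mul_assoc, ← smul_mul_assoc, ← mul_smul_comm, ← h1, ← h2]
      simp only [mul_sub, sub_mul, mul_assoc]
      abel
  · congr 4
    rw [altSign_add n, altSign_one, altSign_zero]
    push_cast
    ring

/-- The square of the Heisenberg field as a quadratic expression in the fermion modes. -/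
theorem coeff_normalOrder_heis_heis (n : ℤ) :
    coeff (normalOrder 0 0 heis heis) n = quad (n + 1)
      (fun i => (1 + altSign n) / 4 * (i : ℂ) + -1 / 2 * (1 / 2 * altSign (n + 1 - i))) := by
  refine sub_eq_zero.mp (eq_zero_of_semicommute (s := 1) (by norm_num) (fun k => ?_) ?_)
  · have h1 := normalOrder_heis_heis_commutator n k
    have h2 := quad_mul_phiMode (n + 1)
      (fun i => (1 + altSign n) / 4 * (i : ℂ) + -1 / 2 * (1 / 2 * altSign (n + 1 - i))) k
    rw [coeff_normalOrder_heis_phi, ← sub_smul, ← add_smul, smul_smul,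
      show n + 1 + k + 1 = n + 1 + 1 + k by ring] at h1
    have h3 := h1.trans ((congrArg (· • phiMode (n + 1 + 1 + k)) ?_).trans h2.symm)
    · rw [one_smul, ← sub_eq_zero, sub_mul, mul_sub, sub_sub_sub_comm, h3, sub_self]
    · simp only [altSign_sub, altSign_add, altSign_neg, altSign_one]
      push_cast
      by_cases hn : 2 ∣ n
      · obtain ⟨i, rfl⟩ := hn
        rw [altSign_two_mul]
        push_cast
        linear_combination (2 * i + k + 3 / 2 - i) * altSign_mul_self k
      · rw [altSign_of_not_two_dvd hn]
        ring
  · rw [LinearMap.sub_apply, map_sub, vacuumFunctional_normalOrder_heis,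
      vacuumFunctional_quad_vacuum, sub_zero]

/-! ### The Virasoro fields with central charge `1` and their deformations -/

theorem coeff_LOne (k : ℤ) : coeff LOne k
    = ((1 + altSign k) / 8) • quad (k + 3) (fun i => (i : ℂ))
      + (-1 / 4 : ℂ) • coeff heis (k + 3) := by
  rw [LOne, map_smul, Pi.smul_apply, coeff_zMul, coeff_normalOrder_heis_heis,
    show k - -2 + 1 = k + 3 by ring, quad_add, quad_smul, quad_smul, ← coeff_heis,
    show k - -2 = k + 2 * 1 by ring, altSign_add, altSign_two_mul]
  module

theorem coeff_LOneTilde (k : ℤ) : coeff LOneTilde k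
    = ((1 + altSign k) / 8) • quad (k + 3) (fun i => (i : ℂ))
      + (1 / 32 : ℂ) • (if k + 4 = 0 then (1 : Module.End ℂ Fock) else 0) := by
  rw [LOneTilde, map_add, map_smul, map_smul, Pi.add_apply, Pi.smul_apply, Pi.smul_apply,
    coeff_zMul, coeff_zMul, map_add, Pi.add_apply, coeff_normalOrder_reflect,
    coeff_normalOrder_deriv_phi, coeff_idField, show k - -2 + 1 = k + 3 by ring,
    show k - -4 = k + 4 by ring, show k - -2 = k + 2 * 1 by ring, altSign_add, altSign_two_mul]
  module

theorem coeff_LFamily (l b : ℂ) (k : ℤ) : coeff (LFamily l b) k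
    = ((1 + altSign k) / 8) • quad (k + 3) (fun i => (i : ℂ))
      + (-1 / 4 + (1 / 2 - l) / 2 * (k + 3) - b) • coeff heis (k + 3)
      + ((16 * b ^ 2 + 8 * b * (1 - 2 * l) - 3 * (1 - 2 * l) ^ 2) / 32) •
        (if k + 4 = 0 then (1 : Module.End ℂ Fock) else 0) := by
  rw [LFamily, map_add, map_sub, map_add, map_smul, map_smul, map_smul]
  simp only [Pi.add_apply, Pi.sub_apply, Pi.smul_apply]
  rw [coeff_LOne, coeff_zMul, coeff_zMul, coeff_zMul, coeff_fieldDeriv, coeff_idField,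
    show k - -2 + 1 = k + 3 by ring, show k - -3 = k + 3 by ring, show k - -4 = k + 4 by ring]
  push_cast
  module

theorem LFamily_half_zero : LFamily (1 / 2) 0 = LOne := by
  refine field_ext fun k => ?_
  rw [coeff_LFamily, coeff_LOne]
  module

theorem LFamily_half_neg_quarter : LFamily (1 / 2) (-1 / 4) = LOneTilde := by
  refine field_ext fun k => ?_
  rw [coeff_LFamily, coeff_LOneTilde]
  module

theorem hasVirasoroModes_LFamily (l b : ℂ) :
    HasVirasoroModes 2 (-2 + 12 * l - 12 * l ^ 2) (LFamily l b) := by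
  refine ⟨fun k hk => ?_, fun m n => ?_⟩
  · have hk' : ¬ 2 ∣ k := hk
    rw [coeff_LFamily, altSign_of_not_two_dvd hk', coeff_heis_eq_zero _ (by lia),
      if_neg (by lia)]
    module
  -- Differentiating h gives the factor -2n - 1 at this mode, whence the terms -an - a/2 with a = ½
  -- - l.
  · have h := modes_commutator (1 / 2 - l) b m n
      (fun n => coeff (LFamily l b) (((2 : ℕ) : ℤ) * (-n - 2))) fun n => by
        rw [coeff_LFamily, heisMode, quarterMode, quad_smul, Nat.cast_ofNat, altSign_two_mul,
          show 2 * (-n - 2) + 3 = -2 * n - 1 by ring]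
        by_cases hn : n = 0
        · rw [if_pos (by lia), if_pos hn]
          push_cast
          module
        · rw [if_neg (by lia), if_neg hn]
          push_cast
          module
    rw [show -2 + 12 * l - 12 * l ^ 2 = 1 - 12 * (1 / 2 - l) ^ 2 by ring]
    exact h

theorem hasVirasoroModes_LOne : HasVirasoroModes 2 1 LOne := by
  have h := hasVirasoroModes_LFamily (1 / 2) 0
  rw [LFamily_half_zero] at h
  norm_num at h
  exact h

theorem hasVirasoroModes_LOneTilde : HasVirasoroModes 2 1 LOneTilde := by
  have h := hasVirasoroModes_LFamily (1 / 2) (-1 / 4)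
  rw [LFamily_half_neg_quarter] at h
  norm_num at h
  exact h

end NeutralFermion

end
open NeutralFermion in
theorem mainTheorem4 :
    ((IsSelfLocal 1 1 0 LHalf ∧ IsVirasoroField 1 (1 / 2) LHalf) ∧
      (IsSelfLocal 1 1 0 LHalfTilde ∧ IsVirasoroField 1 (1 / 2) LHalfTilde) ∧
      LHalfTilde = reflect LHalf) ∧
    ((IsSelfLocal 2 (-1) 0 LOne ∧ IsVirasoroField 2 1 LOne) ∧
      (IsSelfLocal 2 (-1) 0 LOneTilde ∧ IsVirasoroField 2 1 LOneTilde)) ∧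
    ((∀ l b : ℂ, IsSelfLocal 2 (-1) 0 (LFamily l b) ∧
        IsVirasoroField 2 (-2 + 12 * l - 12 * l ^ 2) (LFamily l b)) ∧
      LFamily (1 / 2) 0 = LOne ∧
      LFamily (1 / 2) (-1 / 4) = LOneTilde) := by
  refine ⟨⟨⟨?_, ?_⟩, ⟨?_, ?_⟩, LHalfTilde_eq⟩, ⟨⟨?_, ?_⟩, ?_, ?_⟩, fun l b => ⟨?_, ?_⟩,
    LFamily_half_zero, LFamily_half_neg_quarter⟩
  · exact hasVirasoroModes_LHalf.isSelfLocal_one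
  · exact hasVirasoroModes_LHalf.isVirasoroField
  · exact LHalfTilde_eq ▸ hasVirasoroModes_LHalf.reflect.isSelfLocal_one
  · exact LHalfTilde_eq ▸ hasVirasoroModes_LHalf.reflect.isVirasoroField
  · exact hasVirasoroModes_LOne.isSelfLocal_two
  · exact hasVirasoroModes_LOne.isVirasoroField
  · exact hasVirasoroModes_LOneTilde.isSelfLocal_two
  · exact hasVirasoroModes_LOneTilde.isVirasoroField
  · exact (hasVirasoroModes_LFamily l b).isSelfLocal_two
  · exact (hasVirasoroModes_LFamily l b).isVirasoroField
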